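/- For $\theta\in(0,1]$, $0<t\le n$, $0\le s\le t$ and $0<r<1$ define $\phi_{r,\theta}^{s,t}:\mathbb{R}^n\to\mathbb{R}$ by $$ \phi_{r,\theta}^{s,t}(x)=\begin{cases}1 & 0\le |x|<r,\\ \left(\frac{r}{|x|}\right)^{s} & r\le|x|<r^{\theta},\\ \frac{r^{\theta(t-s)+s}}{|x|^{t}} & r^{\theta}\le|x|.\end{cases} $$ For a non-empty bounded set $E\subset\mathbb{R}^n$ let $\mathcal{M}(\overline{E})$ be the set of Borel probability measures supported on the closure $\overline{E}$, and let $$ C_{r,\theta}^{s,t}(E)=\left(\inf_{\mu\in\mathcal{M}(\overline{E})}\int\int\phi_{r,\theta}^{s,t}(x-y)\,d\mu(x)\,d\mu(y)\right)^{-1}. $$ **Corollary.** Let $E\subset\mathbb{R}^n$ be non-empty and bounded and let $\theta\in(0,1]$. For each $t\in(0,n]$ there is a unique $s\in[0,t]$ with $\liminf_{r\to0^+}\frac{\log C_{r,\theta}^{s,t}(E)}{-\log r}=s$, denoted $\underline{\dim}_{\,\theta}^{t}E$ (the lower $\theta$-intermediate dimension profile of $E$), and a unique $s\in[0,t]$ with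 $\limsup_{r\to0^+}\frac{\log C_{r,\theta}^{s,t}(E)}{-\log r}=s$, denoted $\overline{\dim}_{\,\theta}^{t}E$ (the upper $\theta$-intermediate dimension profile of $E$). The functions $f,g:(0,n]\to[0,n]$ defined by $$ f(t)=\underline{\dim}_{\,\theta}^{t}E,\qquad g(t)=\overline{\dim}_{\,\theta}^{t}E $$ are continuous. -/

import Mathlib

open MeasureTheory Filter Topology Set

noncomputable section

/-- The kernel `φ_{r,θ}^{s,m}` on `ℝⁿ`. -/
def profileKernel {n : ℕ} (θ s m r : ℝ) (x : EuclideanSpace ℝ (Fin n)) : ℝ :=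
  if ‖x‖ < r then 1
  else if ‖x‖ < r ^ θ then (r / ‖x‖) ^ s
  else r ^ (θ * (m - s) + s) / ‖x‖ ^ m

/-- The Borel probability measures on `ℝⁿ` supported on `K`. It is used for closed sets `K` only,
where `μ Kᶜ = 0` says that the support of `μ` is contained in `K`. -/
def probMeasuresOn {n : ℕ} (K : Set (EuclideanSpace ℝ (Fin n))) :
    Set (Measure (EuclideanSpace ℝ (Fin n))) :=
  {μ | IsProbabilityMeasure μ ∧ μ Kᶜ = 0}

/-- The energy of `μ` with respect to the kernel `φ_{r,θ}^{s,m}`. -/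
def profileEnergy {n : ℕ} (θ s m r : ℝ) (μ : Measure (EuclideanSpace ℝ (Fin n))) : ℝ :=
  ∫ y, (∫ x, profileKernel θ s m r (x - y) ∂μ) ∂μ

/-- The capacity `C_{r,θ}^{s,m}(E)`; for a bounded set it is that of the (compact) closure. -/
def profileCapacity {n : ℕ} (θ s m r : ℝ) (E : Set (EuclideanSpace ℝ (Fin n))) : ℝ :=
  (sInf (profileEnergy θ s m r '' probMeasuresOn (closure E)))⁻¹

/-- `s ∈ [0,m]` and `liminf_{r → 0⁺} log C_{r,θ}^{s,m}(E) / (-log r) = s`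
(the lower limit is taken in the extended reals). -/
def IsLowerProfile {n : ℕ} (θ m : ℝ) (E : Set (EuclideanSpace ℝ (Fin n))) (s : ℝ) : Prop :=
  s ∈ Icc 0 m ∧
    liminf (fun r : ℝ => ((Real.log (profileCapacity θ s m r E) / (-Real.log r) : ℝ) : EReal))
      (𝓝[>] 0) = (s : EReal)

/-- `s ∈ [0,m]` and `limsup_{r → 0⁺} log C_{r,θ}^{s,m}(E) / (-log r) = s`
(the upper limit is taken in the extended reals). -/
def IsUpperProfile {n : ℕ} (θ m : ℝ) (E : Set (EuclideanSpace ℝ (Fin n))) (s : ℝ) : Prop :=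
  s ∈ Icc 0 m ∧
    limsup (fun r : ℝ => ((Real.log (profileCapacity θ s m r E) / (-Real.log r) : ℝ) : EReal))
      (𝓝[>] 0) = (s : EReal)

/-- The lower intermediate dimension profile: the `s` with `IsLowerProfile θ m E s`
(an arbitrary real number if there is none). -/
def lowerProfile {n : ℕ} (θ m : ℝ) (E : Set (EuclideanSpace ℝ (Fin n))) : ℝ :=
  Classical.epsilon (IsLowerProfile θ m E)

/-- The upper intermediate dimension profile: the `s` with `IsUpperProfile θ m E s`
(an arbitrary real number if there is none). -/
def upperProfile {n : ℕ} (θ m : ℝ) (E : Set (EuclideanSpace ℝ (Fin n))) : ℝ :=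
  Classical.epsilon (IsUpperProfile θ m E)

end

/-!
Write `F_r(s, t) = log C_{r,θ}^{s,t}(E) / (-log r)` and let `D ≥ 1` bound the diameter of `E`. When
`s` grows to `s'` and `t` to `t'`, the kernel decreases, but on differences of points of
`closure E` at most by the factor `r ^ ((1 - θ) (s' - s)) * (r ^ θ / D) ^ (t' - t)`
(`profileKernel_anti`, `mul_profileKernel_le`). Integrating, taking the infimum over all measures
and then logarithms turns this into
`F_r(s, t) ≤ F_r(s', t') ≤ F_r(s, t) + (1 - θ) (s' - s) + (t' - t) (θ + log D / (-log r))`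
(`logCapacityRatio_le`). For `s = t = 0` the kernel is constantly `1`, so `F_r(0, 0) = 0`.

The lower, or upper, limit `G(s, t)` as `r → 0⁺` therefore satisfies `G(0, 0) = 0` and
`G(s, t) ≤ G(s', t') ≤ G(s, t) + (1 - θ) (s' - s) + θ (t' - t)`. As `θ > 0`, the map `G(·, t)` is a
strict contraction, and it maps `[0, t]` into itself, so it has exactly one fixed point there; the
joint estimate makes this fixed point a nondecreasing `1`-Lipschitz function of `t`
(`fixedPoint_mono_lipschitz`, `fixedPoint_family`).
-/

open MeasureTheory Filter Topology Set

/-! ### The kernel -/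

section Kernel

variable {n : ℕ} {θ s s' m m' r D : ℝ}

lemma profileKernel_zero_zero (x : EuclideanSpace ℝ (Fin n)) :
    profileKernel θ 0 0 r x = 1 := by
  simp [profileKernel]

lemma profileKernel_nonneg (hr : 0 < r) (x : EuclideanSpace ℝ (Fin n)) :
    0 ≤ profileKernel θ s m r x := by
  unfold profileKernel
  split_ifs <;> positivity

/-- The tail of the kernel, as a product of a power of `r` and a power of `r ^ θ / ‖x‖ ≤ 1`. -/
lemma profileKernel_tail (hr : 0 < r) {a : ℝ} (ha : 0 < a) :
    r ^ (θ * (m - s) + s) / a ^ m = r ^ ((1 - θ) * s) * (r ^ θ / a) ^ m := by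
  rw [Real.div_rpow (by positivity) ha.le, ← Real.rpow_mul hr.le, ← mul_div_assoc,
    ← Real.rpow_add hr]
  ring_nf

lemma profileKernel_anti (hθ : θ ≤ 1) (hr : 0 < r) (hr1 : r < 1)
    (hs : s ≤ s') (hm : m ≤ m') (x : EuclideanSpace ℝ (Fin n)) :
    profileKernel θ s' m' r x ≤ profileKernel θ s m r x := by
  unfold profileKernel
  split_ifs with h1 h2
  · exact le_rfl
  · have hx : 0 < ‖x‖ := hr.trans_le (not_lt.1 h1)
    exact Real.rpow_le_rpow_of_exponent_ge (by positivity)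
      ((div_le_one hx).2 (not_lt.1 h1)) hs
  · have hx : 0 < ‖x‖ := hr.trans_le (not_lt.1 h1)
    rw [profileKernel_tail hr hx, profileKernel_tail hr hx]
    have hp : 0 < r ^ θ / ‖x‖ := by positivity
    exact mul_le_mul
      (Real.rpow_le_rpow_of_exponent_ge hr hr1.le
        (mul_le_mul_of_nonneg_left hs (sub_nonneg.2 hθ)))
      (Real.rpow_le_rpow_of_exponent_ge hp ((div_le_one hx).2 (not_lt.1 h2)) hm)
      (by positivity) (by positivity)

lemma profileKernel_le_one (hθ : θ ≤ 1) (hr : 0 < r) (hr1 : r < 1)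
    (hs : 0 ≤ s) (hm : 0 ≤ m) (x : EuclideanSpace ℝ (Fin n)) :
    profileKernel θ s m r x ≤ 1 :=
  (profileKernel_anti hθ hr hr1 hs hm x).trans_eq (profileKernel_zero_zero x)

lemma mul_profileKernel_le (hθ0 : 0 ≤ θ) (hθ : θ ≤ 1) (hr : 0 < r) (hr1 : r < 1) (hD : 1 ≤ D)
    (hs : s ≤ s') (hm : m ≤ m') {x : EuclideanSpace ℝ (Fin n)} (hx : ‖x‖ ≤ D) :
    r ^ ((1 - θ) * (s' - s)) * (r ^ θ / D) ^ (m' - m) * profileKernel θ s m r x ≤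
      profileKernel θ s' m' r x := by
  have hD0 : 0 < D := one_pos.trans_le hD
  have hs' : 0 ≤ s' - s := sub_nonneg.2 hs
  have hm' : 0 ≤ m' - m := sub_nonneg.2 hm
  have hA : r ^ ((1 - θ) * (s' - s)) ≤ 1 :=
    Real.rpow_le_one hr.le hr1.le (mul_nonneg (sub_nonneg.2 hθ) hs')
  have hB : (r ^ θ / D) ^ (m' - m) ≤ 1 :=
    Real.rpow_le_one (by positivity)
      ((div_le_one hD0).2 ((Real.rpow_le_one hr.le hr1.le hθ0).trans hD)) hm'
  unfold profileKernel
  split_ifs with h1 h2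
  · rw [mul_one]
    exact mul_le_one₀ hA (by positivity) hB
  · have hx0 : 0 < ‖x‖ := hr.trans_le (not_lt.1 h1)
    have hq : r ^ (1 - θ) ≤ r / ‖x‖ := by
      rw [Real.rpow_sub hr, Real.rpow_one]
      gcongr
    have hA' : r ^ ((1 - θ) * (s' - s)) ≤ (r / ‖x‖) ^ (s' - s) := by
      rw [Real.rpow_mul hr.le]
      exact Real.rpow_le_rpow (by positivity) hq hs'
    calc r ^ ((1 - θ) * (s' - s)) * (r ^ θ / D) ^ (m' - m) * (r / ‖x‖) ^ s
        ≤ (r / ‖x‖) ^ (s' - s) * 1 * (r / ‖x‖) ^ s := by gcongr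
      _ = (r / ‖x‖) ^ s' := by
        rw [mul_one, ← Real.rpow_add (by positivity), sub_add_cancel]
  · have hx0 : 0 < ‖x‖ := hr.trans_le (not_lt.1 h1)
    rw [profileKernel_tail hr hx0, profileKernel_tail hr hx0]
    have hp : 0 < r ^ θ / ‖x‖ := by positivity
    calc r ^ ((1 - θ) * (s' - s)) * (r ^ θ / D) ^ (m' - m) *
          (r ^ ((1 - θ) * s) * (r ^ θ / ‖x‖) ^ m)
        ≤ r ^ ((1 - θ) * (s' - s)) * (r ^ θ / ‖x‖) ^ (m' - m) *
          (r ^ ((1 - θ) * s) * (r ^ θ / ‖x‖) ^ m) := by gcongr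
      _ = (r ^ ((1 - θ) * (s' - s)) * r ^ ((1 - θ) * s)) *
          ((r ^ θ / ‖x‖) ^ (m' - m) * (r ^ θ / ‖x‖) ^ m) := by ring
      _ = r ^ ((1 - θ) * s') * (r ^ θ / ‖x‖) ^ m' := by
        rw [← Real.rpow_add hr, ← Real.rpow_add hp, sub_add_cancel, ← mul_add, sub_add_cancel]

lemma measurable_profileKernel :
    Measurable (profileKernel θ s m r : EuclideanSpace ℝ (Fin n) → ℝ) := by
  unfold profileKernel
  refine Measurable.ite (measurableSet_lt measurable_norm measurable_const) measurable_const ?_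
  refine Measurable.ite (measurableSet_lt measurable_norm measurable_const) ?_ ?_
  · exact (measurable_const.div measurable_norm).pow_const _
  · exact measurable_const.div (measurable_norm.pow_const _)

end Kernel

/-! ### Energies and capacities -/

section Capacity

variable {n : ℕ} {θ s s' m m' r D c : ℝ} {E K : Set (EuclideanSpace ℝ (Fin n))}

lemma integrable_profileKernel (hθ : θ ≤ 1) (hr : 0 < r) (hr1 : r < 1) (hs : 0 ≤ s) (hm : 0 ≤ m)
    (μ : Measure (EuclideanSpace ℝ (Fin n))) [IsProbabilityMeasure μ]
    (y : EuclideanSpace ℝ (Fin n)) :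
    Integrable (fun x => profileKernel θ s m r (x - y)) μ := by
  refine Integrable.of_bound
    (measurable_profileKernel.comp (measurable_id.sub_const y)).aestronglyMeasurable 1
    (.of_forall fun x => ?_)
  rw [Real.norm_of_nonneg (profileKernel_nonneg hr _)]
  exact profileKernel_le_one hθ hr hr1 hs hm _

lemma integrable_integral_profileKernel (hθ : θ ≤ 1) (hr : 0 < r) (hr1 : r < 1) (hs : 0 ≤ s)
    (hm : 0 ≤ m) (μ : Measure (EuclideanSpace ℝ (Fin n))) [IsProbabilityMeasure μ] :
    Integrable (fun y => ∫ x, profileKernel θ s m r (x - y) ∂μ) μ := by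
  have hmeas : StronglyMeasurable (fun p : EuclideanSpace ℝ (Fin n) × EuclideanSpace ℝ (Fin n) =>
      profileKernel θ s m r (p.2 - p.1)) :=
    (measurable_profileKernel.comp (measurable_snd.sub measurable_fst)).stronglyMeasurable
  refine Integrable.of_bound hmeas.integral_prod_right'.aestronglyMeasurable 1
    (.of_forall fun y => ?_)
  rw [Real.norm_of_nonneg (integral_nonneg fun x => profileKernel_nonneg hr _)]
  calc ∫ x, profileKernel θ s m r (x - y) ∂μ ≤ ∫ _, (1 : ℝ) ∂μ :=
        integral_mono (integrable_profileKernel hθ hr hr1 hs hm μ y) (integrable_const _)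
          fun x => profileKernel_le_one hθ hr hr1 hs hm _
    _ = 1 := by simp

lemma mul_profileEnergy_le (hθ : θ ≤ 1) (hr : 0 < r) (hr1 : r < 1) (hs : 0 ≤ s) (hm : 0 ≤ m)
    (hs' : 0 ≤ s') (hm' : 0 ≤ m')
    (h : ∀ x ∈ K, ∀ y ∈ K, c * profileKernel θ s m r (x - y) ≤ profileKernel θ s' m' r (x - y))
    {μ : Measure (EuclideanSpace ℝ (Fin n))} (hμ : μ ∈ probMeasuresOn K) :
    c * profileEnergy θ s m r μ ≤ profileEnergy θ s' m' r μ := by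
  obtain ⟨hprob, hK⟩ := hμ
  have hae : ∀ᵐ x ∂μ, x ∈ K := mem_ae_iff.2 hK
  unfold profileEnergy
  rw [← integral_const_mul]
  refine integral_mono_ae ((integrable_integral_profileKernel hθ hr hr1 hs hm μ).const_mul c)
    (integrable_integral_profileKernel hθ hr hr1 hs' hm' μ) ?_
  filter_upwards [hae] with y hy
  rw [← integral_const_mul]
  refine integral_mono_ae ((integrable_profileKernel hθ hr hr1 hs hm μ y).const_mul c)
    (integrable_profileKernel hθ hr hr1 hs' hm' μ y) ?_
  filter_upwards [hae] with x hx
  exact h x hx y hy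

lemma profileEnergy_nonneg (hr : 0 < r) (μ : Measure (EuclideanSpace ℝ (Fin n))) :
    0 ≤ profileEnergy θ s m r μ :=
  integral_nonneg fun _ => integral_nonneg fun _ => profileKernel_nonneg hr _

lemma probMeasuresOn_nonempty (hK : K.Nonempty) (hKm : MeasurableSet K) :
    (probMeasuresOn K).Nonempty := by
  obtain ⟨x, hx⟩ := hK
  refine ⟨Measure.dirac x, inferInstance, ?_⟩
  simp [Measure.dirac_apply' x hKm.compl, hx]

lemma mul_sInf_profileEnergy_le (hθ : θ ≤ 1) (hr : 0 < r) (hr1 : r < 1) (hs : 0 ≤ s) (hm : 0 ≤ m)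
    (hs' : 0 ≤ s') (hm' : 0 ≤ m') (hc : 0 ≤ c) (hK : (probMeasuresOn K).Nonempty)
    (h : ∀ x ∈ K, ∀ y ∈ K, c * profileKernel θ s m r (x - y) ≤ profileKernel θ s' m' r (x - y)) :
    c * sInf (profileEnergy θ s m r '' probMeasuresOn K) ≤
      sInf (profileEnergy θ s' m' r '' probMeasuresOn K) := by
  refine le_csInf (hK.image _) ?_
  rintro _ ⟨μ, hμ, rfl⟩
  refine le_trans (mul_le_mul_of_nonneg_left (csInf_le ⟨0, ?_⟩ ⟨μ, hμ, rfl⟩) hc)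
    (mul_profileEnergy_le hθ hr hr1 hs hm hs' hm' h hμ)
  rintro _ ⟨ν, -, rfl⟩
  exact profileEnergy_nonneg hr ν

lemma sInf_profileEnergy_zero_zero (hK : (probMeasuresOn K).Nonempty) :
    sInf (profileEnergy θ 0 0 r '' probMeasuresOn K) = 1 := by
  have : profileEnergy θ 0 0 r '' probMeasuresOn K = {1} := by
    rw [← hK.image_const (1 : ℝ)]
    refine image_congr fun μ hμ => ?_
    have := hμ.1
    simp [profileEnergy, profileKernel_zero_zero]
  rw [this, csInf_singleton]

lemma logCapacityRatio_zero_zero (hE : E.Nonempty) :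
    Real.log (profileCapacity θ 0 0 r E) / (-Real.log r) = 0 := by
  rw [profileCapacity, sInf_profileEnergy_zero_zero
    (probMeasuresOn_nonempty hE.closure isClosed_closure.measurableSet)]
  simp

/-- The quotient `log C / (-log r)` is nondecreasing in both exponents, and grows by at most
`1 - θ` per unit of the first and by `θ + log D / (-log r)` per unit of the second. -/
lemma logCapacityRatio_le (hθ0 : 0 ≤ θ) (hθ : θ ≤ 1) (hr : 0 < r) (hr1 : r < 1) (hD : 1 ≤ D)
    (hE : E.Nonempty) (hED : ∀ x ∈ closure E, ∀ y ∈ closure E, ‖x - y‖ ≤ D)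
    (hs : 0 ≤ s) (hs' : s ≤ s') (hm : 0 ≤ m) (hm' : m ≤ m') :
    Real.log (profileCapacity θ s m r E) / (-Real.log r) ≤
        Real.log (profileCapacity θ s' m' r E) / (-Real.log r) ∧
      Real.log (profileCapacity θ s' m' r E) / (-Real.log r) ≤
        Real.log (profileCapacity θ s m r E) / (-Real.log r) +
          ((1 - θ) * (s' - s) + (m' - m) * (θ + Real.log D / (-Real.log r))) := by
  have hK := probMeasuresOn_nonempty hE.closure isClosed_closure.measurableSet
  have hlog : 0 < -Real.log r := neg_pos.2 (Real.log_neg hr hr1)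
  have hD0 : 0 < D := one_pos.trans_le hD
  -- Comparison with the constant kernel shows that the infimum of the energies is positive.
  have hpos : ∀ a b : ℝ, 0 ≤ a → 0 ≤ b →
      0 < sInf (profileEnergy θ a b r '' probMeasuresOn (closure E)) := by
    intro a b ha hb
    have h := mul_sInf_profileEnergy_le hθ hr hr1 le_rfl le_rfl ha hb
      (c := r ^ ((1 - θ) * (a - 0)) * (r ^ θ / D) ^ (b - 0)) (by positivity) hK
      fun x hx y hy => mul_profileKernel_le hθ0 hθ hr hr1 hD ha hb (hED x hx y hy)
    rw [sInf_profileEnergy_zero_zero hK] at h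
    exact lt_of_lt_of_le (by positivity) h
  have hI := hpos s m hs hm
  have hI' := hpos s' m' (hs.trans hs') (hm.trans hm')
  have hup := mul_sInf_profileEnergy_le hθ hr hr1 (hs.trans hs') (hm.trans hm') hs hm
    zero_le_one hK fun x _ y _ => (one_mul _).trans_le
      (profileKernel_anti (m := m) hθ hr hr1 hs' hm' (x - y))
  have hlow := mul_sInf_profileEnergy_le hθ hr hr1 hs hm (hs.trans hs') (hm.trans hm')
    (c := r ^ ((1 - θ) * (s' - s)) * (r ^ θ / D) ^ (m' - m)) (by positivity) hK
    fun x hx y hy => mul_profileKernel_le hθ0 hθ hr hr1 hD hs' hm' (hED x hx y hy)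
  rw [one_mul] at hup
  have hup' := Real.log_le_log hI' hup
  have hlow' := Real.log_le_log (by positivity) hlow
  rw [Real.log_mul (by positivity) hI.ne', Real.log_mul (by positivity) (by positivity),
    Real.log_rpow hr, Real.log_rpow (by positivity), Real.log_div (by positivity) hD0.ne',
    Real.log_rpow hr] at hlow'
  simp only [profileCapacity, Real.log_inv]
  constructor
  · gcongr
  · rw [div_add' _ _ _ hlog.ne']
    gcongr
    have : ((1 - θ) * (s' - s) + (m' - m) * (θ + Real.log D / (-Real.log r))) * (-Real.log r) =
        -((1 - θ) * (s' - s) * Real.log r + (m' - m) * (θ * Real.log r - Real.log D)) := by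
      have hr0 : Real.log r ≠ 0 := (Real.log_neg hr hr1).ne
      field_simp
      ring
    rw [this]
    linarith

end Capacity

/-! ### Limits of quotients -/

section Limits

lemma liminf_coe_le_add {α : Type*} {l : Filter α} [l.NeBot] {u v w : α → ℝ} {c : ℝ}
    (h : ∀ᶠ a in l, u a ≤ v a + w a) (hw : Tendsto w l (𝓝 c)) :
    liminf (fun a => (u a : EReal)) l ≤ liminf (fun a => (v a : EReal)) l + c := by
  have hw' : limsup (fun a => (w a : EReal)) l = c :=
    ((continuous_coe_real_ereal.tendsto c).comp hw).limsup_eq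
  calc liminf (fun a => (u a : EReal)) l
      ≤ liminf ((fun a => (w a : EReal)) + fun a => (v a : EReal)) l := by
        refine liminf_le_liminf ?_
        filter_upwards [h] with a ha
        rw [Pi.add_apply, ← EReal.coe_add, add_comm]
        exact_mod_cast ha
    _ ≤ limsup (fun a => (w a : EReal)) l + liminf (fun a => (v a : EReal)) l :=
        EReal.liminf_add_le (by simp [hw']) (by simp [hw'])
    _ = _ := by rw [hw', add_comm]

lemma limsup_coe_le_add {α : Type*} {l : Filter α} [l.NeBot] {u v w : α → ℝ} {c : ℝ}
    (h : ∀ᶠ a in l, u a ≤ v a + w a) (hw : Tendsto w l (𝓝 c)) :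
    limsup (fun a => (u a : EReal)) l ≤ limsup (fun a => (v a : EReal)) l + c := by
  have hw' : limsup (fun a => (w a : EReal)) l = c :=
    ((continuous_coe_real_ereal.tendsto c).comp hw).limsup_eq
  calc limsup (fun a => (u a : EReal)) l
      ≤ limsup ((fun a => (v a : EReal)) + fun a => (w a : EReal)) l := by
        refine limsup_le_limsup ?_
        filter_upwards [h] with a ha
        rw [Pi.add_apply, ← EReal.coe_add]
        exact_mod_cast ha
    _ ≤ limsup (fun a => (v a : EReal)) l + limsup (fun a => (w a : EReal)) l :=
        EReal.limsup_add_le (by simp [hw']) (by simp [hw'])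
    _ = _ := by rw [hw']

lemma tendsto_growth_bound (θ D a b : ℝ) :
    Tendsto (fun r : ℝ => (1 - θ) * a + b * (θ + Real.log D / (-Real.log r))) (𝓝[>] 0)
      (𝓝 ((1 - θ) * a + θ * b)) := by
  have h : Tendsto (fun r : ℝ => Real.log D / (-Real.log r)) (𝓝[>] 0) (𝓝 0) :=
    tendsto_const_nhds.div_atTop (tendsto_neg_atBot_atTop.comp Real.tendsto_log_nhdsGT_zero)
  have := ((h.const_add θ).const_mul b).const_add ((1 - θ) * a)
  simpa [mul_comm] using this

end Limits

/-! ### Fixed points of a contraction depending on a parameter -/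

section FixedPoint

variable {θ : ℝ} {g : ℝ → ℝ → ℝ}

/-- A fixed point of `g (·) t` is nondecreasing and `1`-Lipschitz in `t`; for `t = t'` this is the
uniqueness of the fixed point. -/
lemma fixedPoint_mono_lipschitz (hθ : 0 < θ)
    (hmono : ∀ s s' t t', 0 ≤ s → s ≤ s' → 0 ≤ t → t ≤ t' → g s t ≤ g s' t')
    (hlip : ∀ s s' t t', 0 ≤ s → s ≤ s' → 0 ≤ t → t ≤ t' →
      g s' t' ≤ g s t + ((1 - θ) * (s' - s) + θ * (t' - t)))
    {s s' t t' : ℝ} (hs : 0 ≤ s) (hs' : 0 ≤ s') (ht : 0 ≤ t) (htt : t ≤ t')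
    (h : g s t = s) (h' : g s' t' = s') : s ≤ s' ∧ s' ≤ s + (t' - t) := by
  rcases le_or_gt s s' with hss | hss
  · have := hlip s s' t t' hs hss ht htt
    exact ⟨hss, by nlinarith⟩
  · have h1 := hmono s s t t' hs le_rfl ht htt
    have h2 := hlip s' s t' t' hs' hss.le (ht.trans htt) le_rfl
    nlinarith

lemma exists_fixedPoint (hθ : 0 ≤ θ) (hθ1 : θ ≤ 1) (h0 : g 0 0 = 0)
    (hmono : ∀ s s' t t', 0 ≤ s → s ≤ s' → 0 ≤ t → t ≤ t' → g s t ≤ g s' t')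
    (hlip : ∀ s s' t t', 0 ≤ s → s ≤ s' → 0 ≤ t → t ≤ t' →
      g s' t' ≤ g s t + ((1 - θ) * (s' - s) + θ * (t' - t)))
    {t : ℝ} (ht : 0 ≤ t) : ∃ s ∈ Icc 0 t, g s t = s := by
  have hcont : ContinuousOn (fun s => g s t) (Icc 0 t) := by
    have hle : ∀ x ∈ Icc 0 t, ∀ y ∈ Icc 0 t, x ≤ y → |g y t - g x t| ≤ |y - x| := by
      intro x hx y hy hxy
      have h1 := hmono x y t t hx.1 hxy ht le_rfl
      have h2 := hlip x y t t hx.1 hxy ht le_rfl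
      rw [abs_of_nonneg (sub_nonneg.2 h1), abs_of_nonneg (sub_nonneg.2 hxy)]
      nlinarith
    refine (LipschitzOnWith.of_dist_le_mul (K := 1) fun x hx y hy => ?_).continuousOn
    simp only [Real.dist_eq, NNReal.coe_one, one_mul]
    rcases le_total x y with hxy | hxy
    · rw [abs_sub_comm, abs_sub_comm x]
      exact hle x hx y hy hxy
    · exact hle y hy x hx hxy
  have hmaps : MapsTo (fun s => g s t) (Icc 0 t) (Icc 0 t) := by
    intro s hs
    have h1 := hmono 0 s 0 t le_rfl hs.1 le_rfl ht
    have h2 := hlip 0 s 0 t le_rfl hs.1 le_rfl ht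
    rw [h0] at h1 h2
    exact ⟨h1, by nlinarith [hs.2]⟩
  exact exists_mem_Icc_isFixedPt_of_mapsTo hcont ht hmaps

/-- The conclusion for one profile, stated for an arbitrary extended-real family `G` in place of
the lower or upper limit. -/
lemma fixedPoint_family (hθ : 0 < θ) (hθ1 : θ ≤ 1) {G : ℝ → ℝ → EReal} {P : ℝ → ℝ → Prop}
    (hP : ∀ t s, P t s ↔ s ∈ Icc 0 t ∧ G s t = (s : EReal)) (h0 : G 0 0 = 0)
    (hmono : ∀ s s' t t', 0 ≤ s → s ≤ s' → 0 ≤ t → t ≤ t' → G s t ≤ G s' t')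
    (hlip : ∀ s s' t t', 0 ≤ s → s ≤ s' → 0 ≤ t → t ≤ t' →
      G s' t' ≤ G s t + ((1 - θ) * (s' - s) + θ * (t' - t) : ℝ)) (b : ℝ) :
    (∀ t ∈ Ioc 0 b, ∃! s, P t s) ∧
    MapsTo (fun t => Classical.epsilon (P t)) (Ioc 0 b) (Icc 0 b) ∧
    ContinuousOn (fun t => Classical.epsilon (P t)) (Ioc 0 b) := by
  have hreal : ∀ s t, 0 ≤ s → 0 ≤ t → ((G s t).toReal : EReal) = G s t := by
    intro s t hs ht
    have h1 := hmono 0 s 0 t le_rfl hs le_rfl ht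
    have h2 := hlip 0 s 0 t le_rfl hs le_rfl ht
    rw [h0] at h1 h2
    rw [zero_add] at h2
    exact EReal.coe_toReal (h2.trans_lt (EReal.coe_lt_top _)).ne
      ((EReal.bot_lt_zero).trans_le h1).ne'
  have hmono' : ∀ s s' t t', 0 ≤ s → s ≤ s' → 0 ≤ t → t ≤ t' →
      (G s t).toReal ≤ (G s' t').toReal := by
    intro s s' t t' hs hss ht htt
    have := hmono s s' t t' hs hss ht htt
    rw [← hreal s t hs ht, ← hreal s' t' (hs.trans hss) (ht.trans htt)] at this
    exact_mod_cast this
  have hlip' : ∀ s s' t t', 0 ≤ s → s ≤ s' → 0 ≤ t → t ≤ t' →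
      (G s' t').toReal ≤ (G s t).toReal + ((1 - θ) * (s' - s) + θ * (t' - t)) := by
    intro s s' t t' hs hss ht htt
    have := hlip s s' t t' hs hss ht htt
    rw [← hreal s t hs ht, ← hreal s' t' (hs.trans hss) (ht.trans htt)] at this
    exact_mod_cast this
  have hfix : ∀ t s, P t s → (G s t).toReal = s := by
    intro t s h
    rw [((hP t s).1 h).2, EReal.toReal_coe]
  have hex : ∀ t, 0 ≤ t → ∃ s, P t s := by
    intro t ht
    obtain ⟨s, hs, hgs⟩ := exists_fixedPoint (g := fun s t => (G s t).toReal) hθ.le hθ1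
      (by simp [h0]) hmono' hlip' ht
    refine ⟨s, (hP t s).2 ⟨hs, ?_⟩⟩
    rw [← hreal s t hs.1 ht, hgs]
  have hcomp : ∀ t t' s s', 0 ≤ t → t ≤ t' → P t s → P t' s' → s ≤ s' ∧ s' ≤ s + (t' - t) :=
    fun t t' s s' ht htt h h' =>
      fixedPoint_mono_lipschitz (g := fun s t => (G s t).toReal) hθ hmono' hlip'
        ((hP t s).1 h).1.1 ((hP t' s').1 h').1.1 ht htt (hfix t s h) (hfix t' s' h')
  have heps : ∀ t, 0 ≤ t → P t (Classical.epsilon (P t)) :=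
    fun t ht => Classical.epsilon_spec (hex t ht)
  refine ⟨fun t ht => ?_, fun t ht => ?_, ?_⟩
  · refine ⟨_, heps t ht.1.le, fun s hs => ?_⟩
    exact le_antisymm (hcomp t t _ _ ht.1.le le_rfl hs (heps t ht.1.le)).1
      (hcomp t t _ _ ht.1.le le_rfl (heps t ht.1.le) hs).1
  · have h := ((hP t _).1 (heps t ht.1.le)).1
    exact ⟨h.1, h.2.trans ht.2⟩
  · have hle : ∀ x, 0 ≤ x → ∀ y, x ≤ y →
        |Classical.epsilon (P y) - Classical.epsilon (P x)| ≤ |y - x| := by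
      intro x hx y hxy
      have h := hcomp x y _ _ hx hxy (heps x hx) (heps y (hx.trans hxy))
      rw [abs_of_nonneg (sub_nonneg.2 h.1), abs_of_nonneg (sub_nonneg.2 hxy)]
      linarith [h.2]
    refine (LipschitzOnWith.of_dist_le_mul (K := 1) fun x hx y hy => ?_).continuousOn
    simp only [Real.dist_eq, NNReal.coe_one, one_mul]
    rcases le_total x y with hxy | hxy
    · rw [abs_sub_comm, abs_sub_comm x]
      exact hle x hx.1.le y hxy
    · exact hle y hy.1.le x hxy

end FixedPoint

/-! ### Continuity of the dimension profiles -/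

theorem corollary3p7 {n : ℕ} (E : Set (EuclideanSpace ℝ (Fin n))) (hne : E.Nonempty)
    (hE : Bornology.IsBounded E) (θ : ℝ) (hθ : θ ∈ Ioc (0 : ℝ) 1) :
    (∀ t ∈ Ioc (0 : ℝ) n, ∃! s : ℝ, IsLowerProfile θ t E s) ∧
    (∀ t ∈ Ioc (0 : ℝ) n, ∃! s : ℝ, IsUpperProfile θ t E s) ∧
    MapsTo (fun t : ℝ => lowerProfile θ t E) (Ioc (0 : ℝ) n) (Icc (0 : ℝ) n) ∧
    MapsTo (fun t : ℝ => upperProfile θ t E) (Ioc (0 : ℝ) n) (Icc (0 : ℝ) n) ∧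
    ContinuousOn (fun t : ℝ => lowerProfile θ t E) (Ioc (0 : ℝ) n) ∧
    ContinuousOn (fun t : ℝ => upperProfile θ t E) (Ioc (0 : ℝ) n) := by

  obtain ⟨B, hB⟩ := Metric.isBounded_iff.1 hE.closure
  have hED : ∀ x ∈ closure E, ∀ y ∈ closure E, ‖x - y‖ ≤ max B 1 := fun x hx y hy =>
    (dist_eq_norm x y).symm.trans_le ((hB hx hy).trans (le_max_left _ _))
  have hcmp : ∀ s s' t t' : ℝ, 0 ≤ s → s ≤ s' → 0 ≤ t → t ≤ t' → ∀ᶠ r : ℝ in 𝓝[>] 0,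
      Real.log (profileCapacity θ s t r E) / (-Real.log r) ≤
        Real.log (profileCapacity θ s' t' r E) / (-Real.log r) ∧
      Real.log (profileCapacity θ s' t' r E) / (-Real.log r) ≤
        Real.log (profileCapacity θ s t r E) / (-Real.log r) +
          ((1 - θ) * (s' - s) + (t' - t) * (θ + Real.log (max B 1) / (-Real.log r))) := by
    intro s s' t t' hs hss ht htt
    filter_upwards [Ioo_mem_nhdsGT (zero_lt_one (α := ℝ))] with r hr
    exact logCapacityRatio_le hθ.1.le hθ.2 hr.1 hr.2 (le_max_right _ _) hne hED hs hss ht htt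
  have hzero : (fun r : ℝ => ((Real.log (profileCapacity θ 0 0 r E) / (-Real.log r) : ℝ) : EReal))
      =ᶠ[𝓝[>] 0] fun _ => 0 := .of_forall fun r => by
    beta_reduce
    rw [logCapacityRatio_zero_zero hne, EReal.coe_zero]
  obtain ⟨hl1, hl2, hl3⟩ := fixedPoint_family hθ.1 hθ.2
    (P := fun t s => IsLowerProfile θ t E s) (fun t s => Iff.rfl)
    ((liminf_congr hzero).trans (liminf_const 0))
    (fun s s' t t' hs hss ht htt => liminf_le_liminf
      ((hcmp s s' t t' hs hss ht htt).mono fun r hr => EReal.coe_le_coe_iff.2 hr.1))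
    (fun s s' t t' hs hss ht htt => liminf_coe_le_add
      ((hcmp s s' t t' hs hss ht htt).mono fun r hr => hr.2) (tendsto_growth_bound _ _ _ _)) n
  obtain ⟨hu1, hu2, hu3⟩ := fixedPoint_family hθ.1 hθ.2
    (P := fun t s => IsUpperProfile θ t E s) (fun t s => Iff.rfl)
    ((limsup_congr hzero).trans (limsup_const 0))
    (fun s s' t t' hs hss ht htt => limsup_le_limsup
      ((hcmp s s' t t' hs hss ht htt).mono fun r hr => EReal.coe_le_coe_iff.2 hr.1))
    (fun s s' t t' hs hss ht htt => limsup_coe_le_add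
      ((hcmp s s' t t' hs hss ht htt).mono fun r hr => hr.2) (tendsto_growth_bound _ _ _ _)) n
  exact ⟨hl1, hu1, hl2, hu2, hl3, hu3⟩
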